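/- All vector spaces are finite-dimensional over $\mathbb C$. A bialgebra is an associative unital algebra which is also a coassociative counital coalgebra, such that the comultiplication $\Delta$ and the counit $\varepsilon$ are unital algebra homomorphisms. An *involutive bialgebra* is a bialgebra $A$ with two antilinear maps $\sharp,\flat:A\to A$ of order two, the involution and the coinvolution, such that for all $x,y\in A$ $$(xy)^\sharp=y^\sharp x^\sharp,\qquad \Delta(x^\flat)=J(\flat\otimes\flat)\Delta(x),\qquad \Delta(x^\sharp)=(\sharp\otimes\sharp)\Delta(x),\qquad (xy)^\flat=x^\flat y^\flat,$$ where $J(x\otimes y)=y\otimes x$. The dual space $A'$ is a bialgebra with the multiplication, unit, comultiplication and counit adjoint to the comultiplication, counit, multiplication and unit of $A$; its involution is $f\mapsto\big(x\mapsto\overline{f(x^\flat)}\big)$ and its coinvolution is $f\mapsto\big(x\mapsto\overline{f(x^\sharp)}\big)$. The involutive bialgebra $A$ is called *semisimple* if both $A$ and $A'$ are semisimple as algebras with involution, that is, the algebra is semisimple and $x^\sharp x=0$ implies $x=0$ (equivalently, it is isomorphic, as an algebra with involution, to a direct sum of full matrix algebras over $\mathbb C$ with the conjugate transpose). An isomorphism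 of involutive bialgebras is a bialgebra isomorphism that commutes with the involutions and with the coinvolutions. An inverse semigroup is a semigroup $S$ in which every element $a$ has a unique inverse $a^*$, i.e. a unique element with $aa^*a=a$ and $a^*aa^*=a^*$. The semigroup algebra $\mathbb C(S)$ of a finite inverse semigroup $S$ with identity element carries the multiplication of $S$ extended linearly, $\Delta(s)=s\otimes s$, $\varepsilon(s)=1$, the involution $\sum_s c_s s\mapsto\sum_s\overline{c_s}\,s^*$ and the coinvolution $\sum_s c_s s\mapsto\sum_s\overline{c_s}\,s$. **Theorem 2.** The semigroup algebra $\mathbb C(S)$ of every finite inverse unital semigroup $S$ is a semisimple cocommutative involutive bialgebra, and its dual $\mathbb C(S)'$ is a semisimple commutative involutive bialgebra. Conversely, every finite-dimensional semisimple cocommutative (respectively, commutative) involutive bialgebra is isomorphic, as an involutive bialgebra, to the semigroup algebra $\mathbb C(S)$ (respectively, to its dual $\mathbb C(S)'$) of some finite inverse unital semigroup $S$. -/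

import Mathlib

open scoped TensorProduct ComplexConjugate

universe u v

noncomputable section

namespace InvBialg

open Coalgebra

/-! ### The dual bialgebra of a finite-dimensional complex bialgebra -/

/-- The dual algebra `A'` of `A`: the space of linear functionals on `A` with Mathlib's convolution
product `(f * g)(x) = ∑ f(x₁) g(x₂)`, whose unit is the counit of `A`. -/
def DualSpace (A : Type*) [Ring A] [Bialgebra ℂ A] : Type _ :=
  WithConv (A →ₗ[ℂ] ℂ)

section Dual

section Algebra

variable {A : Type*} [Ring A] [Bialgebra ℂ A]

instance : Ring (DualSpace A) := inferInstanceAs (Ring (WithConv (A →ₗ[ℂ] ℂ)))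

instance : Algebra ℂ (DualSpace A) := inferInstanceAs (Algebra ℂ (WithConv (A →ₗ[ℂ] ℂ)))

variable (A) in
/-- Elements of `A'` as linear functionals. -/
def functional : DualSpace A ≃ₗ[ℂ] Module.Dual ℂ A where
  toFun f := WithConv.ofConv f
  invFun f := WithConv.toConv f
  map_add' _ _ := rfl
  map_smul' _ _ := rfl
  left_inv _ := rfl
  right_inv _ := rfl

instance : FunLike (DualSpace A) A ℂ where
  coe f := functional A f
  coe_injective _ _ h := (functional A).injective (DFunLike.coe_injective h)

lemma coe_functional (f : DualSpace A) (x : A) : functional A f x = f x := rfl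

@[ext] lemma dual_ext {f g : DualSpace A} (h : ∀ x, f x = g x) : f = g := DFunLike.ext _ _ h

instance : LinearMapClass (DualSpace A) ℂ A ℂ where
  map_add f := (functional A f).map_add
  map_smulₛₗ f := (functional A f).map_smul

@[simp] lemma functional_symm_apply (φ : Module.Dual ℂ A) (x : A) :
    (functional A).symm φ x = φ x := rfl

@[simp] lemma dual_zero_apply (x : A) : (0 : DualSpace A) x = 0 := rfl

@[simp] lemma dual_add_apply (f g : DualSpace A) (x : A) : (f + g) x = f x + g x := rfl

@[simp] lemma dual_smul_apply (c : ℂ) (f : DualSpace A) (x : A) : (c • f) x = c * f x := rfl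

@[simp] lemma dual_one_apply (x : A) : (1 : DualSpace A) x = counit (R := ℂ) x := rfl

lemma dual_mul_apply (f g : DualSpace A) (x : A) :
    (f * g) x = LinearMap.mul' ℂ ℂ
      (TensorProduct.map (functional A f) (functional A g) (comul (R := ℂ) x)) := rfl

end Algebra

variable (A : Type*) [Ring A] [Bialgebra ℂ A] [Module.Finite ℂ A]

instance : Module.Finite ℂ (DualSpace A) := Module.Finite.equiv (functional A).symm

/-- The canonical isomorphism `A' ⊗ A' ≃ (A ⊗ A)'` for finite-dimensional `A`. -/
def pairing : DualSpace A ⊗[ℂ] DualSpace A ≃ₗ[ℂ] Module.Dual ℂ (A ⊗[ℂ] A) :=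
  (TensorProduct.congr (functional A) (functional A)).trans (TensorProduct.dualDistribEquiv ℂ A A)

@[simp] lemma pairing_tmul (f g : DualSpace A) (x y : A) :
    pairing A (f ⊗ₜ g) (x ⊗ₜ y) = f x * g y := rfl

/-- The canonical isomorphism `A' ⊗ (A' ⊗ A') ≃ (A ⊗ (A ⊗ A))'`. -/
def pairing₃ : DualSpace A ⊗[ℂ] (DualSpace A ⊗[ℂ] DualSpace A) ≃ₗ[ℂ]
    Module.Dual ℂ (A ⊗[ℂ] (A ⊗[ℂ] A)) :=
  (TensorProduct.congr (functional A) (pairing A)).trans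
    (TensorProduct.dualDistribEquiv ℂ A (A ⊗[ℂ] A))

@[simp] lemma pairing₃_tmul (f : DualSpace A) (u : DualSpace A ⊗[ℂ] DualSpace A)
    (x : A) (w : A ⊗[ℂ] A) :
    pairing₃ A (f ⊗ₜ u) (x ⊗ₜ w) = f x * pairing A u w := rfl

/-- The comultiplication of `A'` is adjoint to the multiplication of `A`, and its counit is the
evaluation at the unit of `A`. -/
instance : CoalgebraStruct ℂ (DualSpace A) where
  comul := (pairing A).symm.toLinearMap ∘ₗ (LinearMap.mul' ℂ A).dualMap ∘ₗ
    (functional A).toLinearMap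
  counit := LinearMap.applyₗ (1 : A) ∘ₗ (functional A).toLinearMap

lemma pairing_comul_eq (f : DualSpace A) :
    pairing A (comul (R := ℂ) f) = functional A f ∘ₗ LinearMap.mul' ℂ A := by
  change pairing A ((pairing A).symm _) = _
  rw [LinearEquiv.apply_symm_apply]
  rfl

/-- `(Δ f)(x ⊗ y) = f (x y)`. -/
@[simp] lemma pairing_comul (f : DualSpace A) (x y : A) :
    pairing A (comul (R := ℂ) f) (x ⊗ₜ y) = f (x * y) := by
  simp [pairing_comul_eq, coe_functional]

@[simp] lemma counit_dual (f : DualSpace A) : counit (R := ℂ) f = f 1 := rfl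

lemma pairing₃_lTensor (t : DualSpace A ⊗[ℂ] DualSpace A) (x y z : A) :
    pairing₃ A (comul.lTensor _ t) (x ⊗ₜ (y ⊗ₜ z)) = pairing A t (x ⊗ₜ (y * z)) := by
  induction t with
  | zero => simp
  | add a b ha hb => simp only [map_add, LinearMap.add_apply, ha, hb]
  | tmul f g => simp

lemma pairing₃_assoc (u : DualSpace A ⊗[ℂ] DualSpace A) (g : DualSpace A) (x y z : A) :
    pairing₃ A (TensorProduct.assoc ℂ _ _ _ (u ⊗ₜ g)) (x ⊗ₜ (y ⊗ₜ z)) =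
      pairing A u (x ⊗ₜ y) * g z := by
  induction u with
  | zero => simp
  | add a b ha hb =>
    simp only [TensorProduct.add_tmul, map_add, LinearMap.add_apply, ha, hb, add_mul]
  | tmul f h => simp [mul_assoc]

lemma pairing₃_rTensor (t : DualSpace A ⊗[ℂ] DualSpace A) (x y z : A) :
    pairing₃ A (TensorProduct.assoc ℂ _ _ _ (comul.rTensor _ t)) (x ⊗ₜ (y ⊗ₜ z)) =
      pairing A t ((x * y) ⊗ₜ z) := by
  induction t with
  | zero => simp
  | add a b ha hb => simp only [map_add, LinearMap.add_apply, ha, hb]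
  | tmul f g => simp [pairing₃_assoc]

lemma lid_rTensor (t : DualSpace A ⊗[ℂ] DualSpace A) (y : A) :
    (TensorProduct.lid ℂ _ (counit.rTensor _ t)) y = pairing A t (1 ⊗ₜ y) := by
  induction t with
  | zero => simp
  | add a b ha hb =>
    simp only [map_add, LinearMap.add_apply, dual_add_apply, ha, hb]
  | tmul f g => simp

lemma rid_lTensor (t : DualSpace A ⊗[ℂ] DualSpace A) (y : A) :
    (TensorProduct.rid ℂ _ (counit.lTensor _ t)) y = pairing A t (y ⊗ₜ 1) := by
  induction t with
  | zero => simp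
  | add a b ha hb =>
    simp only [map_add, LinearMap.add_apply, dual_add_apply, ha, hb]
  | tmul f g => simp [mul_comm]

instance : Coalgebra ℂ (DualSpace A) where
  coassoc := by
    refine LinearMap.ext fun f => (pairing₃ A).injective ?_
    ext x y z
    simp [pairing₃_lTensor, pairing₃_rTensor, mul_assoc]
  rTensor_counit_comp_comul := by
    refine LinearMap.ext fun f => (TensorProduct.lid ℂ _).injective ?_
    ext y
    simp [lid_rTensor]
  lTensor_counit_comp_comul := by
    refine LinearMap.ext fun f => (TensorProduct.rid ℂ _).injective ?_
    ext y
    simp [rid_lTensor]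

/-- The pairing is multiplicative for the convolution products. -/
lemma pairing_mul (s t : DualSpace A ⊗[ℂ] DualSpace A) :
    WithConv.toConv (pairing A (s * t)) =
      WithConv.toConv (pairing A s) * WithConv.toConv (pairing A t) := by
  induction s with
  | zero => simp
  | add a b ha hb => simp only [map_add, add_mul, WithConv.toConv_add, ha, hb]
  | tmul f g =>
    induction t with
    | zero => simp
    | add a b ha hb => simp only [map_add, mul_add, WithConv.toConv_add, ha, hb]
    | tmul f₂ g₂ =>
      have key (p q : DualSpace A) : pairing A (p ⊗ₜ q) =
          (Algebra.TensorProduct.lmul' ℂ (S := ℂ)).toLinearMap ∘ₗ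
            TensorProduct.map (functional A p) (functional A q) := by
        ext x y; rfl
      have h := TensorProduct.map_convMul_map (R := ℂ)
        (f := WithConv.toConv (functional A f)) (h := WithConv.toConv (functional A f₂))
        (g := WithConv.toConv (functional A g)) (k := WithConv.toConv (functional A g₂))
      rw [Algebra.TensorProduct.tmul_mul_tmul, key, key, key]
      apply WithConv.ofConv_injective
      rw [← LinearMap.algHom_comp_convMul_distrib
        (f := WithConv.toConv (TensorProduct.map (functional A f) (functional A g)))
        (g := WithConv.toConv (TensorProduct.map (functional A f₂) (functional A g₂)))]
      exact congrArg (fun u => (Algebra.TensorProduct.lmul' ℂ (S := ℂ)).toLinearMap ∘ₗ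
        WithConv.ofConv u) h.symm

/-- The dual of a finite-dimensional bialgebra is a bialgebra. -/
instance : Bialgebra ℂ (DualSpace A) :=
  Bialgebra.mk' ℂ (DualSpace A)
    (by simp)
    (by intro f g; simp [dual_mul_apply, coe_functional, Bialgebra.comul_one,
          Algebra.TensorProduct.one_def])
    (by
      apply (pairing A).injective
      ext x y
      simp [Algebra.TensorProduct.one_def])
    (by
      intro f g
      apply (pairing A).injective
      apply WithConv.toConv_injective
      rw [pairing_mul]
      simp only [pairing_comul_eq]
      exact congrArg WithConv.toConv
        (LinearMap.convMul_comp_coalgHom_distrib (WithConv.toConv (functional A f))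
          (WithConv.toConv (functional A g)) (Bialgebra.mulCoalgHom ℂ A)))

end Dual

/-! ### Involutive bialgebras -/

section Involutive

variable {A : Type*} [Ring A] [Bialgebra ℂ A]

/-- The adjoint of an antilinear operator `φ` on `A`: the antilinear operator on `A'` given by
`(φ' f)(x) = conj (f (φ x))`. -/
def adjoint (φ : A →ₛₗ[starRingEnd ℂ] A) : DualSpace A →ₛₗ[starRingEnd ℂ] DualSpace A where
  toFun f := (functional A).symm
    { toFun := fun x => conj (f (φ x))
      map_add' := fun x y => by simp
      map_smul' := fun c x => by simp }
  map_add' f g := by ext x; simp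
  map_smul' c f := by ext x; simp

/-- An involutive bialgebra: a bialgebra with an involution `sharp` (an antilinear algebra
antiautomorphism of order two) and a coinvolution `flat` (an antilinear coalgebra
antiautomorphism of order two) such that the comultiplication commutes with the involution and the
multiplication commutes with the coinvolution.  (Compatibility of `sharp` and `flat` with the unit
and the counit follows.) -/
structure IsInvolutiveBialgebra (sharp flat : A →ₛₗ[starRingEnd ℂ] A) : Prop where
  sharp_sharp : ∀ x, sharp (sharp x) = x
  sharp_mul : ∀ x y, sharp (x * y) = sharp y * sharp x
  flat_flat : ∀ x, flat (flat x) = x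
  comul_flat : ∀ x, comul (R := ℂ) (flat x) =
    TensorProduct.comm ℂ A A (TensorProduct.map flat flat (comul x))
  comul_sharp : ∀ x, comul (R := ℂ) (sharp x) = TensorProduct.map sharp sharp (comul x)
  flat_mul : ∀ x y, flat (x * y) = flat x * flat y

/-- Semisimplicity of a finite-dimensional involutive bialgebra `A`: the algebra `A` and the dual
algebra `A'` are semisimple, and they are semisimple as algebras with involution, i.e. the
involution of `A` and the involution of `A'` (the adjoint of the coinvolution) are proper
(`x♯ x = 0` only for `x = 0`; in finite dimension this means that the algebra with involution is a
self-adjoint algebra of complex matrices with the usual conjugate transpose). -/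
structure IsSemisimpleInvolutive (sharp flat : A →ₛₗ[starRingEnd ℂ] A) : Prop where
  algebra_semisimple : IsSemisimpleRing A
  coalgebra_semisimple : IsSemisimpleRing (DualSpace A)
  sharp_proper : ∀ x : A, sharp x * x = 0 → x = 0
  flat_proper : ∀ f : DualSpace A, adjoint flat f * f = 0 → f = 0

/-- Isomorphism of involutive bialgebras. -/
def InvolutiveIso {B : Type*} [Ring B] [Bialgebra ℂ B]
    (sharpA flatA : A →ₛₗ[starRingEnd ℂ] A) (sharpB flatB : B →ₛₗ[starRingEnd ℂ] B) : Prop :=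
  ∃ e : A ≃ₐc[ℂ] B, (∀ x, e (sharpA x) = sharpB (e x)) ∧ ∀ x, e (flatA x) = flatB (e x)

end Involutive

/-! ### Inverse semigroups and their semigroup algebras -/

section Semigroup

/-- Inverse semigroup: every element `a` has a unique inverse `b`, i.e. a unique `b` with
`a b a = a` and `b a b = b`. -/
def IsInverseSemigroup (S : Type*) [Semigroup S] : Prop :=
  ∀ a : S, ∃! b : S, a * b * a = a ∧ b * a * b = b

variable {S : Type*} [Monoid S]

/-- The inverse `a*` of an element of an inverse semigroup. -/
def IsInverseSemigroup.inv (h : IsInverseSemigroup S) (a : S) : S := (h a).choose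

/-- The antilinear extension of a map `φ : S → S` to the semigroup algebra:
`∑ c_s s ↦ ∑ conj(c_s) φ(s)`. -/
def antilinearExtension (φ : S → S) :
    MonoidAlgebra ℂ S →ₛₗ[starRingEnd ℂ] MonoidAlgebra ℂ S where
  toFun x := x.coeff.sum fun s c => MonoidAlgebra.single (φ s) (conj c)
  map_add' x y := by
    rw [MonoidAlgebra.coeff_add, Finsupp.sum_add_index'] <;> simp
  map_smul' c x := by
    rw [MonoidAlgebra.coeff_smul, Finsupp.sum_smul_index (by simp), Finsupp.smul_sum]
    simp

/-- The involution of the semigroup algebra of an inverse semigroup: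
`∑ c_s s ↦ ∑ conj(c_s) s*`. -/
def semigroupSharp (h : IsInverseSemigroup S) :
    MonoidAlgebra ℂ S →ₛₗ[starRingEnd ℂ] MonoidAlgebra ℂ S :=
  antilinearExtension h.inv

/-- The coinvolution of a semigroup algebra: `∑ c_s s ↦ ∑ conj(c_s) s`. -/
def semigroupFlat (S : Type*) [Monoid S] :
    MonoidAlgebra ℂ S →ₛₗ[starRingEnd ℂ] MonoidAlgebra ℂ S :=
  antilinearExtension id

end Semigroup

end InvBialg

end

noncomputable section

namespace InvBialg

open Coalgebra

/-! ### Proper involutions on finite-dimensional complex algebras -/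

section ProperInvolution

/-! For a finite inverse monoid `S`, partial bijections of `S` give a *-representation of the
semigroup algebra by partial permutation matrices. It is faithful because a maximal support element
for the natural order is detected by one matrix entry (`lift_regularRep_injective`). Hence the
involution is proper. On the dual, convolution is pointwise multiplication of functions on `S`, so
its involution is proper too, and a proper involution forces semisimplicity (`isSemisimpleRing`).

Conversely, let `A` be cocommutative. Then `A'` is commutative and semisimple, so its characters
separate points. They are evaluations at group-like elements, which therefore form a basis, and `A`
is the algebra of the finite monoid of group-likes. Properness on `A'` forces the coinvolution to
fix each group-like. The involution preserves this monoid, and what remains is that it is the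
inverse of an inverse semigroup. For group-like `s`, the element `a = s♯s` has a repeated power, so
its eigenvalues lie in `{0, 1, -1}`. The value `-1` is excluded by
`eq_zero_of_star_mul_self_eq_neg`, a positivity statement derived from properness alone. Thus `s` is
a partial isometry (`mul_star_mul_self`). Since products of group-like projections are again partial
isometries, these projections commute, which gives unique inverses.

The commutative case follows by applying this to `A'` and identifying `A''` with `A`. -/

/-- An antilinear involutive antiautomorphism `star` of a complex algebra such that
`star x * x = 0` only for `x = 0`. -/
structure IsProperInvolution {A : Type*} [Ring A] [Algebra ℂ A]
    (star : A →ₛₗ[starRingEnd ℂ] A) : Prop where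
  star_star : ∀ x, star (star x) = x
  star_mul : ∀ x y, star (x * y) = star y * star x
  proper : ∀ x, star x * x = 0 → x = 0

variable {A : Type*} [Ring A] [Algebra ℂ A]

/-- The nonzero right ideal `dA` is stable under left multiplication by `h`, since `h(dw) = d(kw)`.
Over `ℂ` this operator has an eigenvector there. -/
lemma exists_eigenvector_mul [Module.Finite ℂ A] {h d k : A} (hd : d ≠ 0) (hk : h * d = d * k) :
    ∃ (w : A) (μ : ℂ), d * w ≠ 0 ∧ h * (d * w) = μ • (d * w) := by
  let V := LinearMap.range (LinearMap.mulLeft ℂ d)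
  have hV : ∀ x ∈ V, LinearMap.mulLeft ℂ h x ∈ V := by
    rintro _ ⟨w, rfl⟩
    exact ⟨k * w, by simp [← mul_assoc, hk]⟩
  have : Nontrivial V :=
    ⟨⟨⟨d, 1, by simp⟩, 0, fun e => hd (by simpa using congrArg Subtype.val e)⟩⟩
  obtain ⟨μ, hμ⟩ := Module.End.exists_eigenvalue ((LinearMap.mulLeft ℂ h).restrict hV)
  obtain ⟨⟨_, w, rfl⟩, hv⟩ := hμ.exists_hasEigenvector
  refine ⟨w, μ, fun e => hv.2 (Subtype.ext (by simpa using e)), ?_⟩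
  simpa using congrArg Subtype.val hv.apply_eq_smul

lemma pow_mul_eigenvector {h v : A} {μ : ℂ} (hv : h * v = μ • v) (n : ℕ) :
    h ^ n * v = μ ^ n • v := by
  induction n with
  | zero => simp
  | succ n ih => rw [pow_succ, mul_assoc, hv, mul_smul_comm, ih, smul_smul, pow_succ']

namespace IsProperInvolution

variable {star : A →ₛₗ[starRingEnd ℂ] A} (hs : IsProperInvolution star)
include hs

lemma eq_zero_of_mul_star {x : A} (h : x * star x = 0) : x = 0 := by
  have := hs.proper (star x) (by rwa [hs.star_star])
  rw [← hs.star_star x, this, map_zero]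

/-- A self-adjoint `d` has no kernel on its own range, because `(dw)♯(dw) = w♯(d(dw))`. -/
lemma eq_zero_of_mul_mul_self {d w : A} (hd : star d = d) (h : d * (d * w) = 0) :
    d * w = 0 := by
  apply hs.proper
  rw [hs.star_mul, hd, mul_assoc, h, mul_zero]

lemma conj_eigenvalue {h v : A} {μ : ℂ} (hh : star h = h) (hv0 : v ≠ 0) (hv : h * v = μ • v) :
    conj μ = μ := by
  have e : star (h * v) * v = star v * (h * v) := by rw [hs.star_mul, hh, mul_assoc]
  rw [hv, map_smulₛₗ, smul_mul_assoc, mul_smul_comm] at e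
  have h0 : star v * v ≠ 0 := fun e => hv0 (hs.proper v e)
  exact smul_left_injective ℂ h0 e

lemma eq_zero_of_pow_eq_zero [Module.Finite ℂ A] {y : A} (hy : star y = y) {n : ℕ}
    (hn : y ^ n = 0) : y = 0 := by
  by_contra h0
  obtain ⟨w, μ, hw, hμ⟩ := exists_eigenvector_mul h0 (rfl : y * y = y * y)
  have h1 := pow_mul_eigenvector hμ n
  rw [hn, zero_mul] at h1
  have h2 : μ = 0 := _root_.eq_zero_of_pow_eq_zero ((smul_eq_zero.1 h1.symm).resolve_right hw)
  rw [h2, zero_smul] at hμ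
  exact hw (hs.eq_zero_of_mul_mul_self hy hμ)

/-- A finite-dimensional complex algebra with a proper involution is semisimple. -/
lemma isSemisimpleRing [Module.Finite ℂ A] : IsSemisimpleRing A := by
  have : IsArtinianRing A := IsArtinianRing.of_finite ℂ A
  rw [IsArtinianRing.isSemisimpleRing_iff_jacobson, eq_bot_iff]
  intro x hx
  obtain ⟨n, hn⟩ := IsArtinianRing.isNilpotent_jacobson_bot (R := A)
  have hy : star x * x ∈ Ideal.jacobson (⊥ : Ideal A) := by
    rw [Ideal.jacobson_bot]
    exact Ideal.mul_mem_left _ _ hx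
  have hyn : (star x * x) ^ n = 0 := by
    have := Ideal.pow_mem_pow hy n
    rwa [hn] at this
  exact hs.proper x (hs.eq_zero_of_pow_eq_zero (by rw [hs.star_mul, hs.star_star]) hyn)

/-- A self-adjoint element with a repeated power has its spectrum in `{0, 1, -1}`. -/
lemma mul_mul_self_of_pow_eq_pow [Module.Finite ℂ A] {a : A} (ha : star a = a) {m n : ℕ}
    (hmn : m ≠ n) (h : a ^ m = a ^ n) : a * a * a = a := by
  rw [← sub_eq_zero]
  by_contra h0
  have hd : star (a * a * a - a) = a * a * a - a := by
    rw [map_sub, hs.star_mul, hs.star_mul, ha, mul_assoc]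
  -- On the right ideal `(a³ - a)A`, an eigenvalue `r` of `a` is real with `r ^ m = r ^ n`, so `r³ =
  -- r`. Then `a³ - a` kills a nonzero element of its own range, which is impossible.
  obtain ⟨w, μ, hw, hμ⟩ := exists_eigenvector_mul (h := a) (k := a) h0 (by noncomm_ring)
  have hr := hs.conj_eigenvalue ha hw hμ
  obtain ⟨r, rfl⟩ := Complex.conj_eq_iff_real.1 hr
  have hp : (r : ℂ) ^ m = (r : ℂ) ^ n := by
    apply smul_left_injective ℂ hw
    simp only [← pow_mul_eigenvector hμ, h]
  have hr3 : r = 0 ∨ r = 1 ∨ r = -1 := by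
    have hp' : |r| ^ m = |r| ^ n := by
      rw [← abs_pow, ← abs_pow]
      exact congrArg _ (by exact_mod_cast hp)
    by_contra! hc
    have h1 : |r| ≠ 1 := by
      intro e
      rcases (abs_eq zero_le_one).1 e with e | e <;> simp_all
    exact hmn (pow_right_injective₀ (abs_pos.2 hc.1) h1 hp')
  have h3 : (r : ℂ) ^ 3 = r := by
    rcases hr3 with rfl | rfl | rfl <;> norm_num
  refine hw (hs.eq_zero_of_mul_mul_self hd ?_)
  have := pow_mul_eigenvector hμ 3
  rw [h3] at this
  rw [sub_mul, hμ, ← this, pow_succ, pow_two, sub_self]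

/-- Minus a nonzero projection is not of the form `star y * y`. -/
lemma eq_zero_of_star_mul_self_eq_neg [Module.Finite ℂ A] {q y : A} (hq : star q = q)
    (hqq : q * q = q) (hyq : y * q = y) (hy : star y * y = -q) : q = 0 := by
  by_contra h0
  have hqy : q * star y = star y := by rw [← hq, ← hs.star_mul, hyq]
  -- Compression of `y + y♯` to the corner of `q`; being self-adjoint, it has a real eigenvalue `r`
  -- with an eigenvector `v` in `qA`.
  let h := q * y + star y * q
  have hqh : q * h = h := by
    simp only [h, mul_add, ← mul_assoc, hqq, hqy]
  have hhq : h * q = h := by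
    simp only [h, add_mul, mul_assoc, hqq, hyq]
  have hh : star h = h := by
    simp only [h, map_add, hs.star_mul, hs.star_star, hq, add_comm]
  obtain ⟨w, μ, hw, hμ⟩ := exists_eigenvector_mul (h := h) (k := h) h0 (by rw [hqh, hhq])
  obtain ⟨r, rfl⟩ := Complex.conj_eq_iff_real.1 (hs.conj_eigenvalue hh hw hμ)
  set v := q * w with hv
  have hqv : q * v = v := by rw [hv, ← mul_assoc, hqq]
  -- For `x = yv + βv` one finds `x♯x = (β² + rβ - 1) v♯v`. The discriminant `r² + 4` is positive,
  -- so a real `β` makes this vanish.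
  obtain ⟨β, hβ⟩ : ∃ β : ℝ, β * β + β * r - 1 = 0 := by
    refine ⟨(-r + √(r ^ 2 + 4)) / 2, ?_⟩
    have := Real.mul_self_sqrt (show 0 ≤ r ^ 2 + 4 by positivity)
    linarith
  have hx : y * v + (β : ℂ) • v = 0 := by
    apply hs.proper
    have e : star (y * v + (β : ℂ) • v) * (y * v + (β : ℂ) • v) =
        star v * (star y * y * v) + (β : ℂ) • (star v * (h * v)) +
          ((β : ℂ) * β) • (star v * v) := by
      have h1 : star v * q = star v := by rw [← hq, ← hs.star_mul, hqv]
      have h2 : star v * (h * v) = star v * y * v + star v * (star y * v) := by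
        simp only [h, add_mul, mul_add, mul_assoc, hqv]
        rw [← mul_assoc (star v) q, h1]
      rw [h2]
      simp only [map_add, hs.star_mul, map_smulₛₗ, Complex.conj_ofReal, add_mul, mul_add,
        smul_mul_assoc, mul_smul_comm, smul_add, smul_smul, mul_assoc]
      abel
    rw [e, hy, hμ, neg_mul, hqv, mul_neg, mul_smul_comm, smul_smul, ← neg_one_smul ℂ, ← add_smul,
      ← add_smul]
    have : ((-1 : ℂ) + β * r + β * β) = 0 := by
      have := congrArg (fun t : ℝ => (t : ℂ)) hβ
      push_cast at this
      linear_combination this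
    rw [this, zero_smul]
  have hyv : y * v = (-(β : ℂ)) • v := by
    rw [neg_smul]; exact eq_neg_of_add_eq_zero_left hx
  -- Now `yv = -βv`, so `(yv)♯(yv)` is both `β² v♯v` and `-v♯v`, forcing `β² = -1` for a real `β`.
  have e : star (y * v) * (y * v) = -(star v * v) := by
    rw [hs.star_mul, mul_assoc, ← mul_assoc (star y), hy, neg_mul, hqv, mul_neg]
  rw [hyv, map_smulₛₗ, smul_mul_assoc, mul_smul_comm, smul_smul, map_neg, Complex.conj_ofReal,
    eq_neg_iff_add_eq_zero] at e
  nth_rewrite 2 [← one_smul ℂ (star v * v)] at e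
  rw [← add_smul] at e
  rcases smul_eq_zero.1 e with e | e
  · have : (β * β + 1 : ℝ) = 0 := by
      have : ((β * β + 1 : ℝ) : ℂ) = 0 := by push_cast; linear_combination e
      exact_mod_cast this
    nlinarith [mul_self_nonneg β]
  · exact hw (hs.proper v e)

/-- If `star s * s` has a repeated power, then `s` is a partial isometry. -/
lemma mul_star_mul_self [Module.Finite ℂ A] {s : A} {m n : ℕ} (hmn : m ≠ n)
    (h : (star s * s) ^ m = (star s * s) ^ n) : s * star s * s = s := by
  obtain ⟨a, ha⟩ : ∃ a, a = star s * s := ⟨_, rfl⟩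
  rw [← ha] at h
  have hsa : star a = a := by rw [ha, hs.star_mul, hs.star_star]
  have h3 := hs.mul_mul_self_of_pow_eq_pow hsa hmn h
  have h3' : a * (a * a) = a := by rw [← mul_assoc, h3]
  have hc : conj (1 / 2 : ℂ) = 1 / 2 := Complex.conj_eq_iff_real.2 ⟨1 / 2, by norm_num⟩
  have ha2 : a * a = a := by
    -- As `a³ = a`, the element `q = (a² - a)/2` is the projection onto the `-1` eigenspace of `a`,
    -- and `y = sq` satisfies `y♯y = qaq = -q`.
    have hq := hs.eq_zero_of_star_mul_self_eq_neg (q := (1 / 2 : ℂ) • (a * a - a))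
      (y := s * ((1 / 2 : ℂ) • (a * a - a)))
      (by rw [map_smulₛₗ, map_sub, hs.star_mul, hsa, hc])
      (by
        simp only [smul_mul_smul_comm, mul_sub, sub_mul, mul_assoc, h3', smul_sub]
        module)
      (by
        simp only [mul_smul_comm, smul_mul_assoc, mul_sub, sub_mul, mul_assoc, h3', smul_sub]
        module)
      (by
        rw [hs.star_mul, mul_assoc, ← mul_assoc (star s), ← ha]
        simp only [map_smulₛₗ, map_sub, hs.star_mul, hsa, hc, mul_smul_comm, smul_mul_assoc,
          mul_sub, sub_mul, mul_assoc, h3', smul_sub]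
        module)
    rw [smul_eq_zero] at hq
    exact sub_eq_zero.1 (hq.resolve_left (by norm_num))
  -- With `a² = a`, `(sa - s)♯(sa - s) = a³ - 2a² + a = 0`.
  have : s * a - s = 0 := by
    apply hs.proper
    rw [map_sub, hs.star_mul, hsa, sub_mul, mul_sub, mul_sub, ← ha, mul_assoc a (star s),
      ← mul_assoc (star s) s a, ← ha, mul_assoc a (star s), ← ha]
    simp [ha2]
  rw [mul_assoc, ← ha]
  exact sub_eq_zero.1 this

/-- Projections `e` and `f` commute if their product is a partial isometry. -/
lemma commute_of_projections {e f : A} (he : star e = e) (hee : e * e = e) (hf : star f = f)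
    (hff : f * f = f) (hef : e * f * star (e * f) * (e * f) = e * f) : e * f = f * e := by
  have h1 : e * (f * (e * f)) = e * f := by
    have : e * f * star (e * f) * (e * f) = e * (f * f) * (e * e) * f := by
      rw [hs.star_mul, he, hf]; noncomm_ring
    rw [this, hff, hee] at hef
    simpa only [mul_assoc] using hef
  -- Since `efef = ef`, all four terms of `(ef - efe)(ef - efe)♯` equal `efe` up to sign and cancel.
  -- Then `ef = efe` is self-adjoint, so it equals `fe`.
  have h2 : e * f - e * f * e = 0 := by
    apply hs.eq_zero_of_mul_star
    have e1 (x : A) : e * (e * x) = e * x := by rw [← mul_assoc, hee]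
    have f1 (x : A) : f * (f * x) = f * x := by rw [← mul_assoc, hff]
    have h1' : e * (f * (e * (f * e))) = e * (f * e) := by
      simpa only [mul_assoc] using congrArg (· * e) h1
    simp only [map_sub, hs.star_mul, he, hf, mul_sub, sub_mul, mul_assoc, e1, f1, h1', sub_self]
  have h3 : e * f = e * f * e := sub_eq_zero.1 h2
  have h4 : f * e = e * f * e := by
    have := congrArg star h3
    simpa only [hs.star_mul, he, hf, mul_assoc] using this
  rw [h3, h4]

end IsProperInvolution

end ProperInvolution

/-! ### Duality of involutive bialgebras -/

section Duality

lemma dual_mul_apply_of_isGroupLikeElem {A : Type*} [Ring A] [Bialgebra ℂ A] (f g : DualSpace A)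
    {x : A} (hx : IsGroupLikeElem ℂ x) : (f * g) x = f x * g x := by
  simp [dual_mul_apply, hx.comul_eq_tmul_self, coe_functional]

lemma adjoint_apply {A : Type*} [Ring A] [Bialgebra ℂ A] (φ : A →ₛₗ[starRingEnd ℂ] A)
    (f : DualSpace A) (x : A) : adjoint φ f x = conj (f (φ x)) := rfl

lemma adjoint_adjoint_of_involutive {A : Type*} [Ring A] [Bialgebra ℂ A]
    {φ : A →ₛₗ[starRingEnd ℂ] A} (hφ : ∀ x, φ (φ x) = x) (f : DualSpace A) :
    adjoint φ (adjoint φ f) = f := by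
  ext x; simp [adjoint_apply, hφ]

variable {A : Type*} [Ring A] [Bialgebra ℂ A]

lemma conj_convolution_map (φ : A →ₛₗ[starRingEnd ℂ] A) (f g : DualSpace A) (t : A ⊗[ℂ] A) :
    conj (LinearMap.mul' ℂ ℂ (TensorProduct.map (functional A f) (functional A g)
      (TensorProduct.map φ φ t))) =
    LinearMap.mul' ℂ ℂ (TensorProduct.map (functional A (adjoint φ f))
      (functional A (adjoint φ g)) t) := by
  induction t with
  | zero => simp
  | add a b ha hb => simp only [map_add, ha, hb]
  | tmul x y => simp [coe_functional, adjoint_apply]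

lemma convolution_comm (f g : DualSpace A) (t : A ⊗[ℂ] A) :
    LinearMap.mul' ℂ ℂ (TensorProduct.map (functional A f) (functional A g)
      (TensorProduct.comm ℂ A A t)) =
    LinearMap.mul' ℂ ℂ (TensorProduct.map (functional A g) (functional A f) t) := by
  induction t with
  | zero => simp
  | add a b ha hb => simp only [map_add, ha, hb]
  | tmul x y => simp [mul_comm]

lemma dual_mul_comm [IsCocomm ℂ A] (f g : DualSpace A) : f * g = g * f := by
  ext x
  rw [dual_mul_apply, dual_mul_apply, ← convolution_comm, Coalgebra.comm_comul]

variable {B : Type*} [Ring B] [Bialgebra ℂ B]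

/-- The linear isomorphism of duals given by precomposition with a bialgebra isomorphism. -/
def dualCongrLinearEquiv (e : A ≃ₐc[ℂ] B) : DualSpace B ≃ₗ[ℂ] DualSpace A :=
  (functional B).trans ((e.toCoalgEquiv.toLinearEquiv.dualMap).trans (functional A).symm)

lemma dualCongrLinearEquiv_apply (e : A ≃ₐc[ℂ] B) (f : DualSpace B) (x : A) :
    dualCongrLinearEquiv e f x = f (e x) := rfl

lemma convolution_dualCongr (e : A ≃ₐc[ℂ] B) (f g : DualSpace B) (t : A ⊗[ℂ] A) :
    LinearMap.mul' ℂ ℂ (TensorProduct.map (functional _ (dualCongrLinearEquiv e f))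
      (functional _ (dualCongrLinearEquiv e g)) t) =
    LinearMap.mul' ℂ ℂ (TensorProduct.map (functional _ f) (functional _ g)
      (TensorProduct.map (e : A →ₗ[ℂ] B) (e : A →ₗ[ℂ] B) t)) := by
  induction t with
  | zero => simp
  | add a b ha hb => simp only [map_add, ha, hb]
  | tmul x y => simp [coe_functional, dualCongrLinearEquiv_apply]

variable [Module.Finite ℂ A]

lemma pairing_map_adjoint (φ : A →ₛₗ[starRingEnd ℂ] A) (t : DualSpace A ⊗[ℂ] DualSpace A)
    (x y : A) :
    pairing A (TensorProduct.map (adjoint φ) (adjoint φ) t) (x ⊗ₜ y) =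
      conj (pairing A t (φ x ⊗ₜ φ y)) := by
  induction t with
  | zero => simp
  | add a b ha hb => simp only [map_add, LinearMap.add_apply, ha, hb]
  | tmul f g => simp [adjoint_apply]

lemma pairing_comm (t : DualSpace A ⊗[ℂ] DualSpace A) (x y : A) :
    pairing A (TensorProduct.comm ℂ _ _ t) (x ⊗ₜ y) = pairing A t (y ⊗ₜ x) := by
  induction t with
  | zero => simp
  | add a b ha hb => simp only [map_add, LinearMap.add_apply, ha, hb]
  | tmul f g => simp [mul_comm]

/-- The dual of an involutive bialgebra is an involutive bialgebra. -/
lemma IsInvolutiveBialgebra.dual {sharp flat : A →ₛₗ[starRingEnd ℂ] A}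
    (h : IsInvolutiveBialgebra sharp flat) :
    IsInvolutiveBialgebra (adjoint flat) (adjoint sharp) where
  sharp_sharp := adjoint_adjoint_of_involutive h.flat_flat
  flat_flat := adjoint_adjoint_of_involutive h.sharp_sharp
  sharp_mul f g := by
    ext x
    rw [adjoint_apply, dual_mul_apply, h.comul_flat, convolution_comm, conj_convolution_map,
      dual_mul_apply]
  flat_mul f g := by
    ext x
    rw [adjoint_apply, dual_mul_apply, h.comul_sharp, conj_convolution_map, dual_mul_apply]
  comul_flat f := by
    apply (pairing A).injective
    ext x y
    simp [pairing_comm, pairing_map_adjoint, adjoint_apply, h.sharp_mul]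
  comul_sharp f := by
    apply (pairing A).injective
    ext x y
    simp [pairing_map_adjoint, adjoint_apply, h.flat_mul]

lemma isCocomm_dual_of_mul_comm (h : ∀ x y : A, x * y = y * x) : IsCocomm ℂ (DualSpace A) where
  comm_comp_comul := by
    refine LinearMap.ext fun f => (pairing A).injective ?_
    ext x y
    simp [pairing_comm, h x y]

variable (A) in
/-- The canonical linear isomorphism of `A` with its second dual. -/
def bidualLinearEquiv : A ≃ₗ[ℂ] DualSpace (DualSpace A) :=
  (Module.evalEquiv ℂ A).trans ((functional A).dualMap.trans (functional (DualSpace A)).symm)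

@[simp] lemma bidualLinearEquiv_apply (x : A) (f : DualSpace A) :
    bidualLinearEquiv A x f = f x := rfl

lemma pairing_map_bidual (t : A ⊗[ℂ] A) (f g : DualSpace A) :
    pairing (DualSpace A) (TensorProduct.map (bidualLinearEquiv A).toLinearMap
      (bidualLinearEquiv A).toLinearMap t) (f ⊗ₜ g) =
    LinearMap.mul' ℂ ℂ (TensorProduct.map (functional A f) (functional A g) t) := by
  induction t with
  | zero => simp
  | add a b ha hb => simp only [map_add, LinearMap.add_apply, ha, hb]
  | tmul x y => simp [coe_functional]

lemma convolution_bidual (x y : A) (t : DualSpace A ⊗[ℂ] DualSpace A) :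
    LinearMap.mul' ℂ ℂ (TensorProduct.map (functional _ (bidualLinearEquiv A x))
      (functional _ (bidualLinearEquiv A y)) t) = pairing A t (x ⊗ₜ y) := by
  induction t with
  | zero => simp
  | add a b ha hb => simp only [map_add, LinearMap.add_apply, ha, hb]
  | tmul f g => simp [coe_functional]

variable (A) in
/-- The canonical isomorphism of the bialgebra `A` with its second dual. -/
def bidual : A ≃ₐc[ℂ] DualSpace (DualSpace A) where
  __ := bidualLinearEquiv A
  counit_comp := by ext x; simp
  map_comp_comul := by
    refine LinearMap.ext fun x => (pairing (DualSpace A)).injective ?_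
    ext f g
    simpa [dual_mul_apply] using pairing_map_bidual (comul (R := ℂ) x) f g
  map_mul' x y := by
    ext f
    simpa [dual_mul_apply] using (convolution_bidual x y (comul (R := ℂ) f)).symm

@[simp] lemma bidual_apply (x : A) (f : DualSpace A) : bidual A x f = f x := rfl

lemma bidual_antilinear (φ : A →ₛₗ[starRingEnd ℂ] A) (x : A) :
    bidual A (φ x) = adjoint (adjoint φ) (bidual A x) := by
  ext f; simp [adjoint_apply]

/-- The dual of a semisimple involutive bialgebra is semisimple. -/
lemma IsSemisimpleInvolutive.dual {sharp flat : A →ₛₗ[starRingEnd ℂ] A}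
    (h : IsSemisimpleInvolutive sharp flat) :
    IsSemisimpleInvolutive (adjoint flat) (adjoint sharp) where
  algebra_semisimple := h.coalgebra_semisimple
  coalgebra_semisimple :=
    (RingEquiv.isSemisimpleRing_iff (bidual A : A ≃+* DualSpace (DualSpace A))).1
      h.algebra_semisimple
  sharp_proper := h.flat_proper
  flat_proper F hF := by
    obtain ⟨x, rfl⟩ := EquivLike.surjective (bidual A) F
    rw [← bidual_antilinear, ← map_mul, EmbeddingLike.map_eq_zero_iff] at hF
    rw [h.sharp_proper x hF, map_zero]

section DualCongr

variable [Module.Finite ℂ B]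

lemma pairing_map_dualCongr (e : A ≃ₐc[ℂ] B) (t : DualSpace B ⊗[ℂ] DualSpace B) (x y : A) :
    pairing A (TensorProduct.map (dualCongrLinearEquiv e).toLinearMap
      (dualCongrLinearEquiv e).toLinearMap t) (x ⊗ₜ y) = pairing B t (e x ⊗ₜ e y) := by
  induction t with
  | zero => simp
  | add a b ha hb => simp only [map_add, LinearMap.add_apply, ha, hb]
  | tmul f g => simp [dualCongrLinearEquiv_apply]

/-- A bialgebra isomorphism induces an isomorphism of the dual bialgebras. -/
def dualCongr (e : A ≃ₐc[ℂ] B) : DualSpace B ≃ₐc[ℂ] DualSpace A where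
  __ := dualCongrLinearEquiv e
  counit_comp := by ext f; simp [dualCongrLinearEquiv_apply]
  map_comp_comul := by
    refine LinearMap.ext fun f => (pairing A).injective ?_
    ext x y
    simpa [dualCongrLinearEquiv_apply] using pairing_map_dualCongr e (comul (R := ℂ) f) x y
  map_mul' f g := by
    ext x
    have h : TensorProduct.map (e : A →ₗ[ℂ] B) (e : A →ₗ[ℂ] B) (comul (R := ℂ) x) =
      comul (R := ℂ) (e x) := CoalgHomClass.map_comp_comul_apply e x
    have := convolution_dualCongr e f g (comul (R := ℂ) x)
    rw [h, ← dual_mul_apply, ← dual_mul_apply] at this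
    exact this.symm

/-- If the dual of `A` is isomorphic to `B`, then `A` is isomorphic to the dual of `B`. -/
lemma InvolutiveIso.of_dual {sharp flat : A →ₛₗ[starRingEnd ℂ] A}
    {sharpB flatB : B →ₛₗ[starRingEnd ℂ] B}
    (h : InvolutiveIso (adjoint flat) (adjoint sharp) sharpB flatB) :
    InvolutiveIso sharp flat (adjoint flatB) (adjoint sharpB) := by
  obtain ⟨e, he₁, he₂⟩ := h
  -- The isomorphism is `A ≅ A''` followed by the transpose of `e⁻¹`. Duality exchanges involution
  -- and coinvolution, so `he₂` yields the claim for `sharp` and `he₁` the one for `flat`.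
  have key (φ : A →ₛₗ[starRingEnd ℂ] A) (ψ : B →ₛₗ[starRingEnd ℂ] B)
      (h : ∀ f, e (adjoint φ f) = ψ (e f)) (x : A) :
      (bidual A).trans (dualCongr e.symm) (φ x) =
        adjoint ψ ((bidual A).trans (dualCongr e.symm) x) := by
    ext b
    obtain ⟨f, rfl⟩ := EquivLike.surjective e b
    rw [adjoint_apply, ← h]
    change e.symm (e f) (φ x) = conj (e.symm (e (adjoint φ f)) x)
    simp [adjoint_apply]
  exact ⟨(bidual A).trans (dualCongr e.symm), key sharp flatB he₂, key flat sharpB he₁⟩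

end DualCongr

end Duality

/-! ### Inverse monoids -/

namespace IsInverseSemigroup

variable {S : Type*} [Monoid S] (hS : IsInverseSemigroup S)
include hS

lemma mul_inv_mul (a : S) : a * hS.inv a * a = a := (hS a).choose_spec.1.1

lemma inv_mul_inv (a : S) : hS.inv a * a * hS.inv a = hS.inv a := (hS a).choose_spec.1.2

lemma eq_inv {a b : S} (h₁ : a * b * a = a) (h₂ : b * a * b = b) : b = hS.inv a :=
  (hS a).choose_spec.2 b ⟨h₁, h₂⟩

lemma inv_inv (a : S) : hS.inv (hS.inv a) = a :=
  (hS.eq_inv (hS.inv_mul_inv a) (hS.mul_inv_mul a)).symm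

lemma inv_of_idempotent {e : S} (he : e * e = e) : hS.inv e = e :=
  (hS.eq_inv (by rw [he, he]) (by rw [he, he])).symm

/-- If `x` is the inverse of `ef`, then `fxe` is also an inverse of `ef`, so `fxe = x`. This makes
`x` idempotent, hence its own inverse, and `ef = x`. -/
lemma idempotent_mul {e f : S} (he : e * e = e) (hf : f * f = f) : e * f * (e * f) = e * f := by
  obtain ⟨x, hx⟩ : ∃ x, x = hS.inv (e * f) := ⟨_, rfl⟩
  have e1 (y : S) : e * (e * y) = e * y := by rw [← mul_assoc, he]
  have f1 (y : S) : f * (f * y) = f * y := by rw [← mul_assoc, hf]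
  have h1 : e * (f * (x * (e * f))) = e * f := by
    simpa only [mul_assoc, ← hx] using hS.mul_inv_mul (e * f)
  have h2 : x * (e * (f * x)) = x := by
    simpa only [mul_assoc, ← hx] using hS.inv_mul_inv (e * f)
  have h2' (y : S) : x * (e * (f * (x * y))) = x * y := by
    simpa only [mul_assoc] using congrArg (· * y) h2
  have hx' : f * (x * e) = x := by
    rw [hx]
    refine hS.eq_inv ?_ ?_
    · simp only [mul_assoc, e1, f1, ← hx, h1]
    · simp only [mul_assoc, e1, f1, ← hx, h2']
  have hxx : x * x = x := by
    rw [← hx']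
    simp only [mul_assoc, h2']
  have : e * f = x := by
    rw [← hS.inv_of_idempotent hxx, hx, hS.inv_inv]
  rw [this, hxx]

/-- Both `ef` and `fe` are idempotent, so `fe` is an inverse of `ef`, as is `ef` itself. -/
lemma idempotent_comm {e f : S} (he : e * e = e) (hf : f * f = f) : e * f = f * e := by
  have e1 (y : S) : e * (e * y) = e * y := by rw [← mul_assoc, he]
  have f1 (y : S) : f * (f * y) = f * y := by rw [← mul_assoc, hf]
  have hef := hS.idempotent_mul he hf
  have hfe := hS.idempotent_mul hf he
  rw [← hS.inv_of_idempotent hef]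
  symm
  refine hS.eq_inv ?_ ?_
  · simpa only [mul_assoc, e1, f1] using hef
  · simpa only [mul_assoc, e1, f1] using hfe

lemma inv_mul_self_idempotent (a : S) : hS.inv a * a * (hS.inv a * a) = hS.inv a * a := by
  rw [← mul_assoc, hS.inv_mul_inv]

lemma mul_inv_self_idempotent (a : S) : a * hS.inv a * (a * hS.inv a) = a * hS.inv a := by
  rw [← mul_assoc, hS.mul_inv_mul]

lemma inv_mul_mul_inv_comm (a b : S) :
    hS.inv a * a * (b * hS.inv b) = b * hS.inv b * (hS.inv a * a) :=
  hS.idempotent_comm (hS.inv_mul_self_idempotent a) (hS.mul_inv_self_idempotent b)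

lemma inv_mul (a b : S) : hS.inv (a * b) = hS.inv b * hS.inv a := by
  symm
  apply hS.eq_inv
  · calc a * b * (hS.inv b * hS.inv a) * (a * b)
        = a * (b * hS.inv b * (hS.inv a * a)) * b := by simp only [mul_assoc]
      _ = (a * hS.inv a * a) * (b * hS.inv b * b) := by
        rw [← hS.inv_mul_mul_inv_comm]; simp only [mul_assoc]
      _ = a * b := by rw [hS.mul_inv_mul, hS.mul_inv_mul]
  · calc hS.inv b * hS.inv a * (a * b) * (hS.inv b * hS.inv a)
        = hS.inv b * (hS.inv a * a * (b * hS.inv b)) * hS.inv a := by simp only [mul_assoc]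
      _ = (hS.inv b * b * hS.inv b) * (hS.inv a * a * hS.inv a) := by
        rw [hS.inv_mul_mul_inv_comm]; simp only [mul_assoc]
      _ = hS.inv b * hS.inv a := by rw [hS.inv_mul_inv, hS.inv_mul_inv]

/-- If `a` is a restriction of `b`, the domain of `a` lies in that of `b`; this drives transitivity
and antisymmetry of the natural order. -/
lemma inv_mul_self_mul_of_le {a b : S} (h : b * (hS.inv a * a) = a) :
    hS.inv b * b * (hS.inv a * a) = hS.inv a * a := by
  have hbb := hS.inv_mul_self_idempotent b
  have haa := hS.inv_mul_self_idempotent a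
  have h1 : a * (hS.inv b * b) = a := by
    nth_rewrite 1 [← h]
    rw [mul_assoc, hS.idempotent_comm haa hbb, ← mul_assoc, ← mul_assoc b, hS.mul_inv_mul, h]
  rw [hS.idempotent_comm hbb haa, mul_assoc, h1]

/-- The natural partial order of an inverse monoid. -/
@[reducible] def naturalOrder : PartialOrder S where
  le s t := t * (hS.inv s * s) = s
  le_refl s := by rw [← mul_assoc, hS.mul_inv_mul]
  le_trans r s t hr hs := by
    rw [← hS.inv_mul_self_mul_of_le hr, ← mul_assoc, hs, hr]
  le_antisymm s t hs ht := by
    have h := hS.inv_mul_self_mul_of_le ht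
    rw [hS.idempotent_comm (hS.inv_mul_self_idempotent s) (hS.inv_mul_self_idempotent t),
      hS.inv_mul_self_mul_of_le hs] at h
    rw [← hs, h, ← mul_assoc, hS.mul_inv_mul]

/-- `s` maps `t` to `u` in the left regular representation by partial bijections. -/
def Maps (s t u : S) : Prop := s * t = u ∧ hS.inv s * s * t = t

lemma maps_inv_iff (s t u : S) : hS.Maps (hS.inv s) t u ↔ hS.Maps s u t := by
  have key (a b c : S) (h : hS.Maps a b c) : hS.Maps (hS.inv a) c b := by
    obtain ⟨rfl, h⟩ := h
    refine ⟨by rwa [← mul_assoc], ?_⟩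
    rw [hS.inv_inv, ← mul_assoc, hS.mul_inv_mul]
  exact ⟨fun h => by simpa only [hS.inv_inv] using key _ _ _ h, key _ _ _⟩

/-- Composition of partial maps: commuting `a⁻¹a` past `bb⁻¹` shows that `t` is in the domain of
`ab` exactly when `t` is in that of `b` and `bt` in that of `a`. -/
lemma maps_mul_iff (a b t u : S) :
    hS.Maps (a * b) t u ↔ hS.Maps b t (b * t) ∧ hS.Maps a (b * t) u := by
  simp only [Maps, hS.inv_mul, true_and]
  constructor
  · rintro ⟨h1, h2⟩
    have h3 : hS.inv b * b * t = t := by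
      calc hS.inv b * b * t = (hS.inv b * b * hS.inv b) * (hS.inv a * (a * (b * t))) := by
            nth_rewrite 1 [← h2]; simp only [mul_assoc]
        _ = t := by rw [hS.inv_mul_inv]; simpa only [mul_assoc] using h2
    refine ⟨h3, by rw [← h1, mul_assoc], ?_⟩
    calc hS.inv a * a * (b * t) = hS.inv a * a * (b * hS.inv b) * (b * t) := by
          nth_rewrite 1 [← h3]; simp only [mul_assoc]
      _ = b * (hS.inv b * hS.inv a * (a * b) * t) := by
          rw [hS.inv_mul_mul_inv_comm]; simp only [mul_assoc]
      _ = b * t := by rw [h2]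
  · rintro ⟨h1, h2, h3⟩
    refine ⟨by rw [mul_assoc, h2], ?_⟩
    calc hS.inv b * hS.inv a * (a * b) * t = hS.inv b * (hS.inv a * a * (b * t)) := by
          simp only [mul_assoc]
      _ = t := by rw [h3, ← mul_assoc, h1]

open Classical in
/-- The left regular representation of a finite inverse monoid by partial permutation matrices. -/
def regularRep [Fintype S] [DecidableEq S] : S →* Matrix S S ℂ where
  toFun s := Matrix.of fun u t => if hS.Maps s t u then 1 else 0
  map_one' := by
    ext u t
    have h1 : hS.inv (1 : S) = 1 := hS.inv_of_idempotent (mul_one 1)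
    simp [Matrix.one_apply, Maps, h1, eq_comm]
  map_mul' a b := by
    ext u t
    simp only [Matrix.mul_apply, Matrix.of_apply, maps_mul_iff]
    rw [Finset.sum_eq_single (b * t)]
    · by_cases h : hS.Maps b t (b * t) <;> simp [h]
    · intro w _ hw
      have : ¬ hS.Maps b t w := fun h => hw h.1.symm
      simp [this]
    · simp

open Classical in
lemma regularRep_apply [Fintype S] [DecidableEq S] (s t u : S) :
    hS.regularRep s u t = if hS.Maps s t u then 1 else 0 := rfl

lemma regularRep_inv [Fintype S] [DecidableEq S] (s : S) :
    hS.regularRep (hS.inv s) = (hS.regularRep s).conjTranspose := by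
  ext u t
  rw [Matrix.conjTranspose_apply, regularRep_apply, regularRep_apply]
  by_cases h : hS.Maps s u t <;> simp [hS.maps_inv_iff, h]

/-- The extension of the left regular representation to the monoid algebra is faithful. -/
lemma lift_regularRep_injective [Fintype S] [DecidableEq S] :
    Function.Injective (MonoidAlgebra.lift ℂ (Matrix S S ℂ) S hS.regularRep) := by
  rw [injective_iff_map_eq_zero]
  intro x hx
  by_contra h0
  let _ := hS.naturalOrder
  have hne : x.coeff.support.Nonempty := by
    rw [Finsupp.support_nonempty_iff]
    exact fun h => h0 (by ext s; simp [h])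
  -- In the entry `(s, s⁻¹s)` an element `t` contributes only if `t s⁻¹s = s`, that is `s ≤ t`. For
  -- `s` maximal in the support, only `s` survives.
  obtain ⟨s, hs⟩ := x.coeff.support.exists_maximal hne
  have h1 := congrFun (congrFun hx s) (hS.inv s * s)
  rw [MonoidAlgebra.lift_apply, Finsupp.sum, Matrix.sum_apply, Finset.sum_eq_single s] at h1
  · have : hS.Maps s (hS.inv s * s) s :=
      ⟨by rw [← mul_assoc, hS.mul_inv_mul], hS.inv_mul_self_idempotent s⟩
    simp only [Matrix.smul_apply, regularRep_apply, this, if_true, Matrix.zero_apply] at h1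
    exact Finsupp.mem_support_iff.1 hs.1 (by simpa using h1)
  · intro t ht hts
    have : ¬ hS.Maps t (hS.inv s * s) s := fun h => hts (le_antisymm (hs.2 ht h.1) h.1)
    simp [regularRep_apply, this]
  · exact fun h => absurd hs.1 h

end IsInverseSemigroup

/-! ### The semigroup algebra of a finite inverse monoid -/

section SemigroupAlgebra

variable {S : Type*} [Monoid S]

@[simp] lemma antilinearExtension_single {S : Type*} (φ : S → S) (s : S) (c : ℂ) :
    antilinearExtension φ (MonoidAlgebra.single s c) = MonoidAlgebra.single (φ s) (conj c) := by
  simp [antilinearExtension]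

lemma comul_monoidAlgebra_single {S : Type*} (s : S) (c : ℂ) :
    comul (R := ℂ) (MonoidAlgebra.single s c) =
      (MonoidAlgebra.single s 1 : MonoidAlgebra ℂ S) ⊗ₜ[ℂ] MonoidAlgebra.single s c := by
  simp

lemma antilinearExtension_mul {φ : S → S} (hφ : ∀ s t, φ (s * t) = φ s * φ t)
    (x y : MonoidAlgebra ℂ S) :
    antilinearExtension φ (x * y) = antilinearExtension φ x * antilinearExtension φ y := by
  induction x using MonoidAlgebra.induction_linear with
  | zero => simp
  | add a b ha hb => simp only [add_mul, map_add, ha, hb]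
  | single s c =>
    induction y using MonoidAlgebra.induction_linear with
    | zero => simp
    | add a b ha hb => simp only [mul_add, map_add, ha, hb]
    | single t d => simp [MonoidAlgebra.single_mul_single, hφ]

lemma antilinearExtension_mul_rev {φ : S → S} (hφ : ∀ s t, φ (s * t) = φ t * φ s)
    (x y : MonoidAlgebra ℂ S) :
    antilinearExtension φ (x * y) = antilinearExtension φ y * antilinearExtension φ x := by
  induction x using MonoidAlgebra.induction_linear with
  | zero => simp
  | add a b ha hb => simp only [add_mul, mul_add, map_add, ha, hb]
  | single s c =>
    induction y using MonoidAlgebra.induction_linear with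
    | zero => simp
    | add a b ha hb => simp only [mul_add, add_mul, map_add, ha, hb]
    | single t d => simp [MonoidAlgebra.single_mul_single, hφ, mul_comm]

lemma antilinearExtension_involutive {φ : S → S} (hφ : ∀ s, φ (φ s) = s) (x : MonoidAlgebra ℂ S) :
    antilinearExtension φ (antilinearExtension φ x) = x := by
  induction x using MonoidAlgebra.induction_linear with
  | zero => simp
  | add a b ha hb => simp only [map_add, ha, hb]
  | single s c => simp [hφ]

lemma comul_antilinearExtension (φ : S → S) (x : MonoidAlgebra ℂ S) :
    comul (R := ℂ) (antilinearExtension φ x) =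
      TensorProduct.map (antilinearExtension φ) (antilinearExtension φ) (comul x) := by
  induction x using MonoidAlgebra.induction_linear with
  | zero => simp
  | add a b ha hb => simp only [map_add, ha, hb]
  | single s c =>
    rw [antilinearExtension_single, comul_monoidAlgebra_single, comul_monoidAlgebra_single,
      TensorProduct.map_tmul]
    simp

lemma isInvolutiveBialgebra_semigroupAlgebra (hS : IsInverseSemigroup S) :
    IsInvolutiveBialgebra (semigroupSharp hS) (semigroupFlat S) where
  sharp_sharp := antilinearExtension_involutive hS.inv_inv
  sharp_mul := antilinearExtension_mul_rev hS.inv_mul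
  flat_flat := antilinearExtension_involutive fun _ => rfl
  comul_flat x := by
    rw [semigroupFlat, ← comul_antilinearExtension, Coalgebra.comm_comul]
  comul_sharp := comul_antilinearExtension _
  flat_mul := antilinearExtension_mul fun _ _ => rfl

lemma lift_regularRep_semigroupSharp [Fintype S] [DecidableEq S] (hS : IsInverseSemigroup S)
    (x : MonoidAlgebra ℂ S) :
    MonoidAlgebra.lift ℂ (Matrix S S ℂ) S hS.regularRep (semigroupSharp hS x) =
      (MonoidAlgebra.lift ℂ (Matrix S S ℂ) S hS.regularRep x).conjTranspose := by
  induction x using MonoidAlgebra.induction_linear with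
  | zero => simp
  | add a b ha hb => simp only [map_add, Matrix.conjTranspose_add, ha, hb]
  | single s c => simp [semigroupSharp, MonoidAlgebra.lift_single, hS.regularRep_inv]

open scoped ComplexOrder in
lemma semigroupSharp_proper [Finite S] (hS : IsInverseSemigroup S) (x : MonoidAlgebra ℂ S)
    (hx : semigroupSharp hS x * x = 0) : x = 0 := by
  classical
  have := Fintype.ofFinite S
  apply hS.lift_regularRep_injective
  rw [map_zero]
  rw [← Matrix.conjTranspose_mul_self_eq_zero, ← lift_regularRep_semigroupSharp, ← map_mul, hx,
    map_zero]

/-- At each `s ∈ S` the product is `|f(s)|²`, since basis elements are group-like. -/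
lemma semigroupFlat_proper (f : DualSpace (MonoidAlgebra ℂ S))
    (hf : adjoint (semigroupFlat S) f * f = 0) : f = 0 := by
  have key (s : S) : f (MonoidAlgebra.single s 1) = 0 := by
    have h := congrArg (fun g : DualSpace (MonoidAlgebra ℂ S) => g (MonoidAlgebra.single s 1)) hf
    rw [dual_mul_apply_of_isGroupLikeElem _ _ (MonoidAlgebra.isGroupLikeElem_single_one s)] at h
    simpa [adjoint_apply, semigroupFlat] using h
  ext x
  induction x using MonoidAlgebra.induction_linear with
  | zero => simp
  | add a b ha hb => rw [map_add, map_add, ha, hb]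
  | single s c =>
    rw [← mul_one c, ← smul_eq_mul, ← MonoidAlgebra.smul_single, map_smul, key]
    simp

lemma isSemisimpleInvolutive_semigroupAlgebra [Finite S] (hS : IsInverseSemigroup S) :
    IsSemisimpleInvolutive (semigroupSharp hS) (semigroupFlat S) := by
  have h := isInvolutiveBialgebra_semigroupAlgebra hS
  exact
    { algebra_semisimple :=
        IsProperInvolution.isSemisimpleRing
          ⟨h.sharp_sharp, h.sharp_mul, semigroupSharp_proper hS⟩
      coalgebra_semisimple :=
        IsProperInvolution.isSemisimpleRing
          ⟨h.dual.sharp_sharp, h.dual.sharp_mul, semigroupFlat_proper⟩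
      sharp_proper := semigroupSharp_proper hS
      flat_proper := semigroupFlat_proper }

end SemigroupAlgebra

/-! ### Group-like elements of a cocommutative semisimple involutive bialgebra -/

section GroupLikeElements

variable {A : Type*} [Ring A] [Bialgebra ℂ A]

/-- The counit axiom gives `ε(x)x = x`. This spares checking that the involutions respect the
counit, which is not among the axioms. -/
lemma isGroupLikeElem_of_comul_eq {x : A} (hx : x ≠ 0) (h : comul (R := ℂ) x = x ⊗ₜ[ℂ] x) :
    IsGroupLikeElem ℂ x where
  comul_eq_tmul_self := h
  counit_eq_one := by
    have h1 := Coalgebra.rTensor_counit_comul (R := ℂ) x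
    rw [h, LinearMap.rTensor_tmul] at h1
    have h2 := congrArg (TensorProduct.lid ℂ A) h1
    rw [TensorProduct.lid_tmul, TensorProduct.lid_tmul] at h2
    exact smul_left_injective ℂ hx h2

/-- Every character of the dual algebra is the evaluation at a group-like element. -/
lemma exists_groupLike_of_character [Module.Finite ℂ A] (φ : DualSpace A →ₐ[ℂ] ℂ) :
    ∃ x : GroupLike ℂ A, ∀ f : DualSpace A, φ f = f x.val := by
  obtain ⟨x, hx⟩ := EquivLike.surjective (bidual A) ((functional (DualSpace A)).symm φ.toLinearMap)
  have hx' (f : DualSpace A) : φ f = f x := by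
    rw [← bidual_apply x f, hx]; rfl
  -- Viewed in `A''`, group-likeness of `x` is exactly unitality and multiplicativity of `φ`.
  refine ⟨⟨x, (isGroupLikeElem_map_equiv (R := ℂ) (bidual A)).1 ⟨?_, ?_⟩⟩, hx'⟩
  · rw [counit_dual, bidual_apply, ← hx', map_one]
  · apply (pairing (DualSpace A)).injective
    ext f g
    simp [← hx']

/-- If the dual algebra is commutative and semisimple, the group-like elements span. -/
lemma span_groupLike_eq_top [Module.Finite ℂ A] [IsCocomm ℂ A] [IsSemisimpleRing (DualSpace A)] :
    Submodule.span ℂ (Set.range (GroupLike.val (R := ℂ) (A := A))) = ⊤ := by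
  by_contra hne
  obtain ⟨f, hf0, hf⟩ := Submodule.exists_le_ker_of_lt_top _ (lt_top_iff_ne_top.2 hne)
  let F : DualSpace A := (functional A).symm f
  have hF (x : GroupLike ℂ A) : F x.val = 0 := hf (Submodule.subset_span ⟨x, rfl⟩)
  let _ : CommRing (DualSpace A) := { (inferInstance : Ring (DualSpace A)) with
    mul_comm := dual_mul_comm }
  -- Each residue field of `A'` is `ℂ`, so each maximal ideal is the kernel of evaluation at some
  -- group-like, where `F` vanishes.
  have hmem : F ∈ Ideal.jacobson (⊥ : Ideal (DualSpace A)) := by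
    rw [Ideal.jacobson, Ideal.mem_sInf]
    rintro m ⟨-, hm⟩
    let _ := Ideal.Quotient.field m
    have : Module.Finite ℂ (DualSpace A ⧸ m) :=
      Module.Finite.of_surjective (Ideal.Quotient.mkₐ ℂ m).toLinearMap
        (Ideal.Quotient.mkₐ_surjective ℂ m)
    let ψ : ℂ ≃ₐ[ℂ] DualSpace A ⧸ m := AlgEquiv.ofBijective (Algebra.ofId ℂ _)
      (IsAlgClosed.algebraMap_bijective_of_isIntegral (k := ℂ))
    obtain ⟨x, hx⟩ := exists_groupLike_of_character
      ((ψ.symm : (DualSpace A ⧸ m) →ₐ[ℂ] ℂ).comp (Ideal.Quotient.mkₐ ℂ m))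
    have h0 := hx F
    rw [hF, AlgHom.comp_apply] at h0
    have h1 : Ideal.Quotient.mkₐ ℂ m F = 0 := (map_eq_zero_iff ψ.symm ψ.symm.injective).1 h0
    exact Ideal.Quotient.eq_zero_iff_mem.1 h1
  rw [Ideal.jacobson_bot, IsSemisimpleRing.jacobson_eq_bot] at hmem
  exact hf0 ((functional A).symm.map_eq_zero_iff.1 hmem)

variable [Module.Finite ℂ A] [IsCocomm ℂ A] [IsSemisimpleRing (DualSpace A)]

variable (A) in
/-- The basis of group-like elements. -/
def groupLikeBasis : Module.Basis (GroupLike ℂ A) ℂ A :=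
  Module.Basis.mk linearIndep_groupLikeVal span_groupLike_eq_top.ge

@[simp] lemma groupLikeBasis_apply (s : GroupLike ℂ A) : groupLikeBasis A s = s.val := by
  simp [groupLikeBasis]

lemma liftGroupLike_bijective :
    Function.Bijective (MonoidAlgebra.liftGroupLikeBialgHom (R := ℂ) (A := A)) := by
  have h (x : MonoidAlgebra ℂ (GroupLike ℂ A)) :
      MonoidAlgebra.liftGroupLikeBialgHom (R := ℂ) (A := A) x =
        (groupLikeBasis A).repr.symm x.coeff := by
    induction x using MonoidAlgebra.induction_linear with
    | zero => simp
    | add a b ha hb => simp only [map_add, MonoidAlgebra.coeff_add, ha, hb]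
    | single s c => simp [MonoidAlgebra.lift_single]
  rw [show ⇑(MonoidAlgebra.liftGroupLikeBialgHom (R := ℂ) (A := A)) =
    (groupLikeBasis A).repr.symm ∘ MonoidAlgebra.coeff from funext h]
  exact (groupLikeBasis A).repr.symm.bijective.comp MonoidAlgebra.coeffEquiv.bijective

variable (A) in
/-- The isomorphism of a cocommutative cosemisimple bialgebra with the monoid algebra of its
group-like elements. -/
def groupLikeEquiv : MonoidAlgebra ℂ (GroupLike ℂ A) ≃ₐc[ℂ] A :=
  BialgEquiv.ofBijective MonoidAlgebra.liftGroupLikeBialgHom liftGroupLike_bijective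

lemma groupLikeEquiv_single (s : GroupLike ℂ A) (c : ℂ) :
    groupLikeEquiv A (MonoidAlgebra.single s c) = c • s.val := by
  simp [groupLikeEquiv, MonoidAlgebra.lift_single]

lemma groupLikeEquiv_antilinear {φ : A →ₛₗ[starRingEnd ℂ] A} {σ : GroupLike ℂ A → GroupLike ℂ A}
    (h : ∀ s, φ s.val = (σ s).val) (x : A) :
    (groupLikeEquiv A).symm (φ x) = antilinearExtension σ ((groupLikeEquiv A).symm x) := by
  obtain ⟨y, rfl⟩ := EquivLike.surjective (groupLikeEquiv A) x
  apply EquivLike.injective (groupLikeEquiv A)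
  simp only [BialgEquiv.apply_symm_apply, BialgEquiv.symm_apply_apply]
  induction y using MonoidAlgebra.induction_linear with
  | zero => simp
  | add a b ha hb => simp only [map_add, ha, hb]
  | single s c => simp [groupLikeEquiv_single, h]

end GroupLikeElements

/-! ### Monoids with an involution -/

/-- A monoid with an involution for which every element is a partial isometry and any two
projections commute is an inverse monoid. -/
lemma isInverseSemigroup_of_projections_commute {S : Type*} [Monoid S] {σ : S → S}
    (hσ : ∀ s, σ (σ s) = s) (hmul : ∀ s t, σ (s * t) = σ t * σ s) (hreg : ∀ s, s * σ s * s = s)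
    (hcomm : ∀ e f, σ e = e → e * e = e → σ f = f → f * f = f → e * f = f * e) :
    IsInverseSemigroup S := by
  have hreg' (s : S) : σ s * s * σ s = σ s := by simpa only [hσ] using hreg (σ s)
  -- The projections `gσ(g)` and `σ(g)g` commute, and for idempotent `g` their products in the two
  -- orders are `g` and `σ(g)`.
  have hidem (g : S) (hg : g * g = g) : σ g = g := by
    have h1 : σ g * σ g = σ g := by rw [← hmul, hg]
    have h := hcomm (g * σ g) (σ g * g) (by rw [hmul, hσ]) (by rw [← mul_assoc, hreg])
      (by rw [hmul, hσ]) (by rw [← mul_assoc, hreg'])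
    have h2 : g * σ g * (σ g * g) = g := by
      rw [mul_assoc, ← mul_assoc (σ g), h1, ← mul_assoc, hreg]
    have h3 : σ g * g * (g * σ g) = σ g := by
      rw [mul_assoc, ← mul_assoc g, hg, ← mul_assoc, hreg']
    rw [← h3, ← h, h2]
  have hc (e f : S) (he : e * e = e) (hf : f * f = f) : e * f = f * e :=
    hcomm e f (hidem e he) he (hidem f hf) hf
  refine fun a => ⟨σ a, ⟨hreg a, hreg' a⟩, ?_⟩
  rintro b ⟨h1, h2⟩
  have hb : b = b * a * σ a := by
    calc b = b * ((a * σ a * a) * b) := by rw [hreg, ← mul_assoc, h2]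
      _ = b * ((a * σ a) * (a * b)) := by simp only [mul_assoc]
      _ = b * ((a * b) * (a * σ a)) := by
        rw [hc (a * σ a) (a * b) (by rw [← mul_assoc, hreg]) (by rw [← mul_assoc, h1])]
      _ = b * a * b * a * σ a := by simp only [mul_assoc]
      _ = b * a * σ a := by rw [h2]
  have hσa : σ a = b * a * σ a := by
    calc σ a = σ a * (a * b * a) * σ a := by rw [h1, hreg']
      _ = (σ a * a) * (b * a) * σ a := by simp only [mul_assoc]
      _ = (b * a) * (σ a * a) * σ a := by
        rw [hc (σ a * a) (b * a) (by rw [← mul_assoc, hreg']) (by rw [← mul_assoc, h2])]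
      _ = b * a * (σ a * a * σ a) := by simp only [mul_assoc]
      _ = b * a * σ a := by rw [hreg']
  rw [hσa, ← hb]

/-! ### The structure theorem -/

section Structure

variable {A : Type*} [Ring A] [Bialgebra ℂ A] {sharp flat : A →ₛₗ[starRingEnd ℂ] A}

lemma IsInvolutiveBialgebra.isGroupLikeElem_sharp (h : IsInvolutiveBialgebra sharp flat) {x : A}
    (hx : IsGroupLikeElem ℂ x) : IsGroupLikeElem ℂ (sharp x) := by
  refine isGroupLikeElem_of_comul_eq (fun h0 => hx.ne_zero ?_) ?_
  · rw [← h.sharp_sharp x, h0, map_zero]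
  · rw [h.comul_sharp, hx.comul_eq_tmul_self, TensorProduct.map_tmul]

lemma IsInvolutiveBialgebra.isGroupLikeElem_flat (h : IsInvolutiveBialgebra sharp flat) {x : A}
    (hx : IsGroupLikeElem ℂ x) : IsGroupLikeElem ℂ (flat x) := by
  refine isGroupLikeElem_of_comul_eq (fun h0 => hx.ne_zero ?_) ?_
  · rw [← h.flat_flat x, h0, map_zero]
  · rw [h.comul_flat, hx.comul_eq_tmul_self, TensorProduct.map_tmul, TensorProduct.comm_tmul]

variable [Module.Finite ℂ A]

instance : Finite (GroupLike ℂ A) := (linearIndep_groupLikeVal (R := ℂ) (A := A)).finite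

/-- Let `f` be the coordinate functional of `s`. At a group-like `t`, the product of `f` with its
adjoint is `conj (f(t♭)) f(t)`; if `s♭ ≠ s`, this vanishes for all `t`, contradicting properness on
`A'`. -/
lemma IsSemisimpleInvolutive.flat_groupLike [IsCocomm ℂ A] (h : IsInvolutiveBialgebra sharp flat)
    (hs : IsSemisimpleInvolutive sharp flat) (s : GroupLike ℂ A) : flat s.val = s.val := by
  have := hs.coalgebra_semisimple
  by_contra hne
  let f : DualSpace A := (functional A).symm ((groupLikeBasis A).coord s)
  have hf (t : GroupLike ℂ A) (ht : t ≠ s) : f t.val = 0 := by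
    change (groupLikeBasis A).coord s t.val = 0
    rw [← groupLikeBasis_apply, Module.Basis.coord_apply, Module.Basis.repr_self,
      Finsupp.single_eq_of_ne' ht]
  have hfs : f s.val = 1 := by
    change (groupLikeBasis A).coord s s.val = 1
    rw [← groupLikeBasis_apply, Module.Basis.coord_apply, Module.Basis.repr_self,
      Finsupp.single_eq_same]
  have h0 : adjoint flat f * f = 0 := by
    apply (functional A).injective
    refine (groupLikeBasis A).ext fun t => ?_
    rw [map_zero, LinearMap.zero_apply, groupLikeBasis_apply, coe_functional,
      dual_mul_apply_of_isGroupLikeElem _ _ t.2, adjoint_apply]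
    by_cases ht : t = s
    · subst ht
      rw [hf ⟨flat t.val, h.isGroupLikeElem_flat t.2⟩ fun e => hne (congrArg GroupLike.val e)]
      simp
    · rw [hf t ht, mul_zero]
  rw [hs.flat_proper f h0] at hfs
  simp at hfs

/-- A cocommutative semisimple involutive bialgebra is the semigroup algebra of the inverse monoid
of its group-like elements. -/
lemma IsSemisimpleInvolutive.groupLike_involutiveIso [IsCocomm ℂ A]
    (h : IsInvolutiveBialgebra sharp flat) (hs : IsSemisimpleInvolutive sharp flat) :
    ∃ hS : IsInverseSemigroup (GroupLike ℂ A),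
      InvolutiveIso sharp flat (semigroupSharp hS) (semigroupFlat (GroupLike ℂ A)) := by
  have := hs.coalgebra_semisimple
  have hp : IsProperInvolution sharp := ⟨h.sharp_sharp, h.sharp_mul, hs.sharp_proper⟩
  let σ (s : GroupLike ℂ A) : GroupLike ℂ A := ⟨sharp s.val, h.isGroupLikeElem_sharp s.2⟩
  have hσ (s : GroupLike ℂ A) : σ (σ s) = s := GroupLike.ext (h.sharp_sharp _)
  have hreg (s : GroupLike ℂ A) : s * σ s * s = s := by
    -- Powers of an element repeat because the monoid of group-likes is finite.
    obtain ⟨m, n, hmn, hpow⟩ :=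
      Finite.exists_ne_map_eq_of_infinite fun n : ℕ => (σ s * s) ^ n
    exact GroupLike.ext (hp.mul_star_mul_self hmn (congrArg GroupLike.val hpow))
  have hS : IsInverseSemigroup (GroupLike ℂ A) :=
    isInverseSemigroup_of_projections_commute hσ
      (fun s t => GroupLike.ext (h.sharp_mul _ _)) hreg
      fun e f he hee hf hff => GroupLike.ext (hp.commute_of_projections
        (congrArg GroupLike.val he) (congrArg GroupLike.val hee) (congrArg GroupLike.val hf)
        (congrArg GroupLike.val hff) (congrArg GroupLike.val (hreg (e * f))))
  have hinv : hS.inv = σ := funext fun s =>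
    (hS.eq_inv (hreg s) (by simpa only [hσ] using hreg (σ s))).symm
  refine ⟨hS, (groupLikeEquiv A).symm, ?_, ?_⟩
  · rw [semigroupSharp, hinv]
    exact groupLikeEquiv_antilinear fun _ => rfl
  · exact groupLikeEquiv_antilinear (hs.flat_groupLike h)

end Structure

end InvBialg

end

open InvBialg in
/-- The semigroup algebra `ℂ[S]` carries Mathlib's bialgebra structure (diagonal comultiplication,
counit `s ↦ 1`). On the dual, the involution is adjoint to the coinvolution and vice versa. -/
theorem theorem2 :
    (∀ (S : Type u) [Monoid S] [Finite S] (hS : IsInverseSemigroup S),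
      (IsInvolutiveBialgebra (semigroupSharp hS) (semigroupFlat S) ∧
        IsSemisimpleInvolutive (semigroupSharp hS) (semigroupFlat S) ∧
        Coalgebra.IsCocomm ℂ (MonoidAlgebra ℂ S)) ∧
      (IsInvolutiveBialgebra (adjoint (semigroupFlat S)) (adjoint (semigroupSharp hS)) ∧
        IsSemisimpleInvolutive (adjoint (semigroupFlat S)) (adjoint (semigroupSharp hS)) ∧
        ∀ f g : DualSpace (MonoidAlgebra ℂ S), f * g = g * f)) ∧
    (∀ (A : Type v) [Ring A] [Bialgebra ℂ A] [Module.Finite ℂ A]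
      (sharp flat : A →ₛₗ[starRingEnd ℂ] A),
      IsInvolutiveBialgebra sharp flat → IsSemisimpleInvolutive sharp flat →
      (Coalgebra.IsCocomm ℂ A →
        ∃ (S : Type v) (_ : Monoid S) (_ : Finite S) (hS : IsInverseSemigroup S),
          InvolutiveIso sharp flat (semigroupSharp hS) (semigroupFlat S)) ∧
      ((∀ x y : A, x * y = y * x) →
        ∃ (S : Type v) (_ : Monoid S) (_ : Finite S) (hS : IsInverseSemigroup S),
          InvolutiveIso sharp flat
            (adjoint (semigroupFlat S)) (adjoint (semigroupSharp hS)))) := by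
  refine ⟨fun S _ _ hS => ?_, fun A _ _ _ sharp flat h hs => ⟨fun _ => ?_, fun hcomm => ?_⟩⟩
  · have h := isInvolutiveBialgebra_semigroupAlgebra hS
    have hs := isSemisimpleInvolutive_semigroupAlgebra hS
    exact ⟨⟨h, hs, inferInstance⟩, h.dual, hs.dual, dual_mul_comm⟩
  · obtain ⟨hS, e⟩ := hs.groupLike_involutiveIso h
    exact ⟨GroupLike ℂ A, inferInstance, inferInstance, hS, e⟩
  · have := isCocomm_dual_of_mul_comm hcomm
    obtain ⟨hS, e⟩ := hs.dual.groupLike_involutiveIso h.dual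
    exact ⟨GroupLike ℂ (DualSpace A), inferInstance, inferInstance, hS, e.of_dual⟩
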